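/- Let $n\ge 0$ and let $\theta=(\theta_{i,j})_{i,j\in[n]}$ be a random complex matrix whose entries are i.i.d. with distribution $\mathcal D$ on $\mathbb C$. Put $\mu_{p,q}=\mathbb E_{\theta\sim\mathcal D}[\theta^p\,\overline{\theta}^{\,q}]$ and assume $\mu_{2,2}<\infty$, $\mu_{1,0}=0$ and $|\mu_{2,0}|<\mu_{1,1}$. The double-edge normal factor graph $\mathsf N_{\mathrm{DE}}(\theta)$ lives on the complete bipartite graph with left vertices $i\in[n]$ and right vertices $j\in[n]$. Each edge $(i,j)$ carries two variables $\tilde x^{L}_{i,j},\tilde x^{R}_{i,j}\in\{0,1\}^2$, written $\tilde x=(x,x')$. For $x_1,\dots,x_n\in\{0,1\}$ let $f(x_1,\dots,x_n)=1$ if exactly one $x_k$ equals $1$, and $0$ otherwise. The left vertex $i$ has the local function $f((x^L_{i,j})_j)\,f((x'^L_{i,j})_j)$, the right vertex $j$ has the local function $f((x^R_{i,j})_i)\,f((x'^R_{i,j})_i)$, and the edge $(i,j)$ has the local function $[\tilde x^L_{i,j}=\tilde x^R_{i,j}]\cdot W_{i,j}(x^L_{i,j},x'^L_{i,j})$, where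 $W_{i,j}=\begin{pmatrix}1&\overline{\theta_{i,j}}\\ \theta_{i,j}&|\theta_{i,j}|^2\end{pmatrix}$ with rows and columns indexed by $x$ and $x'$ in $\{0,1\}$. The partition sum $Z(\mathsf N_{\mathrm{DE}}(\theta))$ is the sum over all configurations of the product of all local functions. For $M\ge 1$, an $M$-cover $\widetilde{\mathsf N}$ of $\mathsf N_{\mathrm{DE}}(\theta)$ is given by a permutation $\sigma_{i,j}$ of $[M]$ for each edge $(i,j)$: every vertex $v$ is replaced by $M$ copies $(v,1),\dots,(v,M)$, for each $m$ the left copy $(i,m)$ is joined to the right copy $(j,\sigma_{i,j}(m))$, and all copies of vertices and edges keep their local functions. The degree-2 Bethe partition sum is $$Z_{\mathrm B,2}(\mathsf N_{\mathrm{DE}}(\theta))=\sqrt{\big\langle Z(\widetilde{\mathsf N})\big\rangle},$$ where the arithmetic average is over all $2$-covers $\widetilde{\mathsf N}$ of $\mathsf N_{\mathrm{DE}}(\theta)$. For real $a,b,m,c\ge0$ let $$\psi_n(a,b,m,c)=n!\sum_{\sigma\in\mathcal S_n}\prod_{k=1}^n z_k^{c_k(\sigma)},\qquad z_1=a,\quad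 z_k=m\,b^k+c^k\ (k\ge2),$$ where $c_k(\sigma)$ is the number of cycles of length $k$ of $\sigma$ (fixed points being cycles of length $1$); this is $(n!)^2$ times the cycle index of $\mathcal S_n$ evaluated at these $z_k$. Then all the following expectations exist (the integrands are integrable) and $$\mathbb E\big[Z(\mathsf N_{\mathrm{DE}}(\theta))^2\big]=\mathbb E\big[|\operatorname{perm}\theta|^4\big]=\psi_n\big(\mu_{2,2},\,\mu_{1,1}^2,\,2,\,|\mu_{2,0}|^2\big),$$ $$\mathbb E\big[Z_{\mathrm B,2}(\mathsf N_{\mathrm{DE}}(\theta))^2\big]=\psi_n\big(\mu_{2,2},\,\mu_{1,1}^2,\,1,\,|\mu_{2,0}|^2\big).$$ -/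

import Mathlib

open MeasureTheory ProbabilityTheory
open scoped ComplexConjugate Nat

noncomputable section

/-- A normal factor graph on the complete bipartite graph with left vertices `Fin n` and right
vertices `Fin n`. The edge `(i, j)` carries the two variables `xL i j` (on the side of the left
vertex `i`) and `xR i j` (on the side of the right vertex `j`), both with values in the
alphabet `X`, and the edge function `edge i j` of these two variables. -/
structure BipartiteNFG (n : ℕ) (X : Type) where
  left : Fin n → (Fin n → X) → ℂ
  right : Fin n → (Fin n → X) → ℂ
  edge : Fin n → Fin n → X → X → ℂ

namespace BipartiteNFG

variable {n : ℕ} {X : Type} [Fintype X]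

/-- The global function: the product of all local functions. -/
def globalFunction (N : BipartiteNFG n X) (xL xR : Fin n → Fin n → X) : ℂ :=
  (∏ i, N.left i (fun j => xL i j)) * (∏ i, ∏ j, N.edge i j (xL i j) (xR i j)) *
    ∏ j, N.right j (fun i => xR i j)

/-- The partition sum `Z(N)`. -/
def partitionSum (N : BipartiteNFG n X) : ℂ :=
  ∑ xL : Fin n → Fin n → X, ∑ xR : Fin n → Fin n → X, N.globalFunction xL xR

/-- The `M`-covers of the complete bipartite graph: each vertex has the copies `Fin M`, and
for each edge `(i, j)` a permutation of `Fin M` says how the copies of its ends are connected.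
See `coverGraph` and `bijOn_coverGraph`. -/
abbrev Cover (n M : ℕ) : Type := Fin n → Fin n → Equiv.Perm (Fin M)

/-- The partition sum of the `M`-cover of `N` given by `σ`. The `m`-th copy of the edge `(i, j)`
joins copy `m` of the left vertex `i` to copy `σ i j m` of the right vertex `j`; every copy of a
local function is the same function. -/
def coverPartitionSum (N : BipartiteNFG n X) {M : ℕ} (σ : Cover n M) : ℂ :=
  ∑ xL : Fin n → Fin n → Fin M → X, ∑ xR : Fin n → Fin n → Fin M → X,
    (∏ i, ∏ m, N.left i (fun j => xL i j m)) *
      (∏ i, ∏ j, ∏ m, N.edge i j (xL i j m) (xR i j m)) *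
        ∏ j, ∏ m, N.right j (fun i => xR i j ((σ i j).symm m))

/-- The degree-`M` Bethe partition sum: the (principal) `M`-th root of the arithmetic average
of the partition sums of all `M`-covers. -/
def bethePartitionSum (N : BipartiteNFG n X) (M : ℕ) : ℂ :=
  ((∑ σ : Cover n M, N.coverPartitionSum σ) / (Fintype.card (Cover n M) : ℂ)) ^ (1 / (M : ℂ))

end BipartiteNFG

/-- `π` is a covering map from the graph `H` to the graph `G`: a homomorphism which maps the
neighborhood of every vertex `w` bijectively to the neighborhood of `π w`. -/
def IsGraphCover {V W : Type*} (G : SimpleGraph V) (H : SimpleGraph W) (π : W → V) : Prop :=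
  (∀ w w', H.Adj w w' → G.Adj (π w) (π w')) ∧
    ∀ w, Set.BijOn π (H.neighborSet w) (G.neighborSet (π w))

/-- The adjacency relation of the covering graph of the complete bipartite graph given by `σ`. -/
def coverAdj {n M : ℕ} (σ : BipartiteNFG.Cover n M) :
    (Fin n ⊕ Fin n) × Fin M → (Fin n ⊕ Fin n) × Fin M → Prop
  | (Sum.inl i, m), (Sum.inr j, m') => σ i j m = m'
  | (Sum.inr j, m'), (Sum.inl i, m) => σ i j m = m'
  | _, _ => False

/-- The covering graph of the complete bipartite graph given by `σ`. -/
def coverGraph {n M : ℕ} (σ : BipartiteNFG.Cover n M) :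
    SimpleGraph ((Fin n ⊕ Fin n) × Fin M) where
  Adj := coverAdj σ
  symm := ⟨by
    rintro ⟨i | i, m⟩ ⟨j | j, m'⟩ h
    · exact h
    · exact h
    · exact h
    · exact h⟩
  loopless := ⟨by
    rintro ⟨i | i, m⟩ h
    · exact h
    · exact h⟩

/-- The graphs `coverGraph σ` are exactly the `M`-covers of the complete bipartite graph (with
labelled copies of the vertices), each obtained from exactly one `σ`. -/
theorem bijOn_coverGraph (n M : ℕ) :
    Set.BijOn (coverGraph (n := n) (M := M)) Set.univ
      {H | IsGraphCover (completeBipartiteGraph (Fin n) (Fin n)) H Prod.fst} := by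
  refine ⟨?_, ?_, ?_⟩
  · intro σ _
    refine ⟨?_, ?_⟩
    · rintro ⟨i | i, m⟩ ⟨j | j, m'⟩ h
      · exact h.elim
      · simp [completeBipartiteGraph]
      · simp [completeBipartiteGraph]
      · exact h.elim
    · rintro ⟨i | i, m⟩
      · refine ⟨?_, ?_, ?_⟩
        · rintro ⟨j | j, m'⟩ h
          · exact h.elim
          · simp [completeBipartiteGraph]
        · rintro ⟨j | j, m₁⟩ h₁ ⟨k | k, m₂⟩ h₂ h
          · exact h₁.elim
          · exact h₁.elim
          · exact h₂.elim
          · have hjk : j = k := by simpa using h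
            subst hjk
            have e₁ : σ i j m = m₁ := h₁
            have e₂ : σ i j m = m₂ := h₂
            rw [← e₁, ← e₂]
        · rintro (j | j) h
          · simp [completeBipartiteGraph] at h
          · exact ⟨(Sum.inr j, σ i j m), (rfl : σ i j m = σ i j m), rfl⟩
      · refine ⟨?_, ?_, ?_⟩
        · rintro ⟨j | j, m'⟩ h
          · simp [completeBipartiteGraph]
          · exact h.elim
        · rintro ⟨j | j, m₁⟩ h₁ ⟨k | k, m₂⟩ h₂ h
          · have hjk : j = k := by simpa using h
            subst hjk
            have e₁ : σ j i m₁ = m := h₁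
            have e₂ : σ j i m₂ = m := h₂
            rw [(σ j i).injective (e₁.trans e₂.symm)]
          · exact h₂.elim
          · exact h₁.elim
          · exact h₁.elim
        · rintro (j | j) h
          · exact ⟨(Sum.inl j, (σ j i).symm m), (σ j i).apply_symm_apply m, rfl⟩
          · simp [completeBipartiteGraph] at h
  · intro σ _ τ _ h
    funext i j
    ext m
    have h₁ : (coverGraph σ).Adj (Sum.inl i, m) (Sum.inr j, σ i j m) :=
      (rfl : σ i j m = σ i j m)
    rw [h] at h₁
    have h₂ : τ i j m = σ i j m := h₁
    rw [h₂]
  · rintro H ⟨hom, bij⟩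
    have hl : ∀ i j m, ∃! m', H.Adj (Sum.inl i, m) (Sum.inr j, m') := by
      intro i j m
      obtain ⟨⟨w, m'⟩, hw, rfl⟩ := (bij (Sum.inl i, m)).surjOn
        (show Sum.inr j ∈ (completeBipartiteGraph (Fin n) (Fin n)).neighborSet (Sum.inl i) by
          simp [completeBipartiteGraph])
      refine ⟨m', hw, fun k hk => ?_⟩
      have := (bij (Sum.inl i, m)).injOn hk hw rfl
      simpa using this
    have hr : ∀ i j m', ∃! m, H.Adj (Sum.inl i, m) (Sum.inr j, m') := by
      intro i j m'
      obtain ⟨⟨w, m⟩, hw, rfl⟩ := (bij (Sum.inr j, m')).surjOn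
        (show Sum.inl i ∈ (completeBipartiteGraph (Fin n) (Fin n)).neighborSet (Sum.inr j) by
          simp [completeBipartiteGraph])
      refine ⟨m, hw.symm, fun k hk => ?_⟩
      have := (bij (Sum.inr j, m')).injOn hk.symm hw rfl
      simpa using this
    choose f hf hf' using hl
    choose g hg hg' using hr
    refine ⟨fun i j => ⟨f i j, g i j, fun m => (hg' i j _ _ (hf i j m)).symm,
      fun m => (hf' i j _ _ (hg i j m)).symm⟩, trivial, ?_⟩
    ext ⟨i | i, m⟩ ⟨j | j, m'⟩
    · refine ⟨fun h => h.elim, fun h => ?_⟩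
      have := hom _ _ h
      simp [completeBipartiteGraph] at this
    · refine ⟨fun h => ?_, fun h => (hf' i j m m' h).symm⟩
      have e : f i j m = m' := h
      rw [← e]
      exact hf i j m
    · refine ⟨fun h => ?_, fun h => (hf' j i m' m h.symm).symm⟩
      have e : f j i m' = m := h
      rw [← e]
      exact (hf j i m').symm
    · refine ⟨fun h => h.elim, fun h => ?_⟩
      have := hom _ _ h
      simp [completeBipartiteGraph] at this

/-- The check node function: `1` if exactly one of the arguments equals `1`, else `0`. -/
def checkNode {n : ℕ} (x : Fin n → Fin 2) : ℂ :=
  open Classical in if ∃! k, x k = 1 then 1 else 0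

/-- The matrix `W i j`, with rows indexed by `x` and columns by `x'`. -/
def edgeWeight (t : ℂ) (ε : ℝ) : Matrix (Fin 2) (Fin 2) ℂ :=
  !![1, conj t; t, (‖t‖ : ℂ) ^ 2 + (ε : ℂ)]

/-- The double-edge normal factor graph `N_DE(θ, ε)`; its variables are pairs `(x, x')` of
binary variables. -/
def deNFGWithNoise {n : ℕ} (θ : Matrix (Fin n) (Fin n) ℂ) (ε : Matrix (Fin n) (Fin n) ℝ) :
    BipartiteNFG n (Fin 2 × Fin 2) where
  left _ x := checkNode (fun j => (x j).1) * checkNode (fun j => (x j).2)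
  right _ x := checkNode (fun i => (x i).1) * checkNode (fun i => (x i).2)
  edge i j xL xR := if xL = xR then edgeWeight (θ i j) (ε i j) xL.1 xL.2 else 0

/-- The double-edge normal factor graph `N_DE(θ) = N_DE(θ, 0)`. -/
def deNFG {n : ℕ} (θ : Matrix (Fin n) (Fin n) ℂ) : BipartiteNFG n (Fin 2 × Fin 2) :=
  deNFGWithNoise θ 0

/-- The number of cycles of length `k` of `σ`, fixed points being the cycles of length `1`. -/
def cycleCount {n : ℕ} (σ : Equiv.Perm (Fin n)) (k : ℕ) : ℕ :=
  σ.partition.parts.count k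

/-- The cycle index of the symmetric group on `n` letters, evaluated at `z 1, …, z n`. -/
def cycleIndex (n : ℕ) (z : ℕ → ℝ) : ℝ :=
  (1 / (n ! : ℝ)) * ∑ σ : Equiv.Perm (Fin n), ∏ k ∈ Finset.Icc 1 n, z k ^ cycleCount σ k

/-- `(n!)²` times the cycle index at `z 1 = a` and `z k = m b ^ k + c ^ k` for `k ≥ 2`. -/
def psi (n : ℕ) (a b m c : ℝ) : ℝ :=
  (n ! : ℝ) ^ 2 * cycleIndex n (fun k => if k = 1 then a else m * b ^ k + c ^ k)

/-- The mixed moment `μ_{p,q}` of a distribution `D` on `ℂ`. -/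
def mixedMoment (D : Measure ℂ) (p q : ℕ) : ℂ :=
  ∫ z, z ^ p * conj z ^ q ∂D

/-- The moments `μ_{p,p}` are the real numbers `E[|z|^(2p)]`. -/
theorem mixedMoment_self (D : Measure ℂ) (p : ℕ) :
    mixedMoment D p p = ((∫ z, ‖z‖ ^ (2 * p) ∂D : ℝ) : ℂ) := by
  rw [← integral_complex_ofReal]
  unfold mixedMoment
  congr 1
  funext z
  rw [← mul_pow, Complex.mul_conj, Complex.normSq_eq_norm_sq, pow_mul]
  push_cast
  rfl

end

/-! `Z²` is the partition sum of the trivial 2-cover, and the square of the Bethe sum is the average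
over all 2-covers. In both, the two copies of an edge carry a factor `θ^a * conj θ^b`, where `a` and
`b` count their unprimed and primed ones. A cover chooses its permutations independently on the
edges, so averaging replaces the kernel `[x = y]` by the symmetrizer `(1 + swap) / 2`. By
independence of the entries, the expectation replaces `θ^a * conj θ^b` by `μ_{a,b}`.

Since `μ_{1,0} = μ_{0,1} = 0`, no edge may carry exactly one of the four ones that the two copies of
a vertex place on their edges. These ones therefore all share an edge or split into two pairs. Of
the three pairings, two match `θ` with `conj θ` (weights `μ_{1,1}`, `μ_{1,1}`) and one matches `θ`
with `θ` (weights `μ_{2,0}`, `μ_{0,2}`); see `sum_checkPair_mul_prod`.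

For the diagonal kernel, the choices at the left vertices form two permutations `σ`, `o`, and the
right vertices force the pairing type to be constant on the cycles of `σ⁻¹ o`. A cycle of length `k
≥ 2` contributes `2 μ_{1,1}^{2k} + |μ_{2,0}|^{2k}`, a fixed point contributes `μ_{2,2}`, and the
free `σ` contributes `n!` (`latticeSum_vertexFun`).

The symmetrizer has rank 2 on the four states of weight `μ_{1,1}`. A change of basis with constants
`±i` (`PairState.lift`) represents its range by the two states of a single pairing; it is compatible
with the vertex functions because `(u+v)(u'+v') - (u-v)(u'-v') = 2(uv' + vu')`. The kernel is then
diagonal with one type in place of two, which turns the coefficient 2 into 1. -/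

noncomputable section

/-! ### Cycles of a permutation and labelings constant on them. -/

open Equiv.Perm in
/-- A product over the cycles of a permutation, fixed points being cycles of length `1`. -/
theorem prod_sameCycle_card {α : Type*} [Fintype α] [DecidableEq α] (σ : Equiv.Perm α)
    (z : ℕ → ℂ) [Fintype (Quotient (SameCycle.setoid σ))]
    [DecidableEq (Quotient (SameCycle.setoid σ))] :
    ∏ q : Quotient (SameCycle.setoid σ),
      z (Finset.univ.filter (fun i => Quotient.mk (SameCycle.setoid σ) i = q)).card =
    (σ.partition.parts.map z).prod := by
  classical
  set mk : α → Quotient (SameCycle.setoid σ) := Quotient.mk (SameCycle.setoid σ) with hmk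
  have mk_eq : ∀ i j, mk i = mk j ↔ σ.SameCycle i j := fun i j => Quotient.eq
  have out_eq : ∀ q, mk q.out = q := fun q => Quotient.out_eq q
  have card_fixed : ∀ i, σ i = i → (Finset.univ.filter (fun j => mk j = mk i)).card = 1 := by
    intro i hi
    rw [Finset.card_eq_one]
    refine ⟨i, ?_⟩
    ext j
    simp only [Finset.mem_filter, Finset.mem_univ, true_and, Finset.mem_singleton, mk_eq]
    refine ⟨fun h => ?_, fun h => h ▸ SameCycle.refl _ _⟩
    exact ((sameCycle_comm.1 h).eq_of_left hi).symm
  have card_moved : ∀ i, σ i ≠ i →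
      (Finset.univ.filter (fun j => mk j = mk i)).card = (σ.cycleOf i).support.card := by
    intro i hi
    congr 1
    ext j
    simp only [Finset.mem_filter, Finset.mem_univ, true_and, mk_eq]
    rw [mem_support_cycleOf_iff' hi]
    exact sameCycle_comm
  have out_moved : ∀ q, (∃ i, σ i ≠ i ∧ mk i = q) → σ q.out ≠ q.out := by
    rintro q ⟨i, hi, rfl⟩ h
    have := ((mk_eq _ _).1 (out_eq (mk i))).eq_of_left h
    rw [this] at h
    exact hi h
  rw [parts_partition, Multiset.map_add, Multiset.prod_add, Multiset.map_replicate,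
    Multiset.prod_replicate, cycleType_def, Multiset.map_map]
  -- Classes with a moved point match the entries of `cycleType`; the others match the ones that
  -- `partition` adds for the fixed points.
  rw [← Finset.prod_filter_mul_prod_filter_not Finset.univ
    (fun q => ∃ i, σ i ≠ i ∧ mk i = q)]
  congr 1
  · change _ = ∏ c ∈ σ.cycleFactorsFinset, z c.support.card
    refine Finset.prod_nbij (fun q => σ.cycleOf q.out) ?_ ?_ ?_ ?_
    · intro q hq
      rw [cycleOf_mem_cycleFactorsFinset_iff, mem_support]
      exact out_moved q (by simpa using hq)
    · intro q hq q' hq' h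
      have h1 := out_moved q (by simpa using hq)
      have : σ.SameCycle q'.out q.out := by
        have : q.out ∈ (σ.cycleOf q'.out).support := by
          rw [← show σ.cycleOf q.out = σ.cycleOf q'.out from h, mem_support_cycleOf_iff' h1]
        exact ((mem_support_cycleOf_iff).1 this).1
      rw [← out_eq q, ← out_eq q', mk_eq]
      exact this.symm
    · intro c hc
      obtain ⟨a, ha⟩ := (mem_cycleFactorsFinset_iff.1 hc).1.nonempty_support
      have hσ : σ a ≠ a := by
        have := mem_cycleFactorsFinset_support_le hc ha
        rwa [mem_support] at this
      refine ⟨mk a, by simpa using ⟨a, hσ, rfl⟩, ?_⟩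
      rw [cycle_is_cycleOf ha hc]
      exact ((mk_eq _ _).1 (out_eq (mk a))).cycleOf_eq
    · intro q hq
      have h1 := out_moved q (by simpa using hq)
      conv_lhs => rw [← out_eq q]
      rw [card_moved _ h1]
  · rw [Finset.prod_congr rfl (g := fun _ => z 1), Finset.prod_const]
    · congr 1
      rw [← Finset.card_compl]
      symm
      refine Finset.card_nbij mk ?_ ?_ ?_
      · intro i hi
        simp only [Finset.coe_compl, Set.mem_compl_iff, SetLike.mem_coe, mem_support,
          not_not] at hi
        simp only [Finset.coe_filter, Finset.mem_univ, true_and, Set.mem_ofPred_eq]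
        rintro ⟨j, hj, h⟩
        have := ((mk_eq _ _).1 h.symm).eq_of_left hi
        exact hj (this ▸ hi)
      · intro i hi j hj h
        simp only [Finset.coe_compl, Set.mem_compl_iff, SetLike.mem_coe, mem_support,
          not_not] at hi
        exact ((mk_eq _ _).1 h).eq_of_left hi
      · intro q hq
        simp only [Finset.coe_filter, Finset.mem_univ, true_and, Set.mem_ofPred_eq] at hq
        refine ⟨q.out, ?_, out_eq q⟩
        simp only [Finset.coe_compl, Set.mem_compl_iff, SetLike.mem_coe, mem_support, not_not]
        by_contra h
        exact hq ⟨q.out, h, out_eq q⟩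
    · intro q hq
      simp only [Finset.mem_filter, Finset.mem_univ, true_and] at hq
      conv_lhs => rw [← out_eq q]
      rw [card_fixed]
      by_contra h
      exact hq ⟨q.out, h, out_eq q⟩

/-- Summing over the labelings that are constant on the cycles of `σ`. -/
theorem sum_invariant_labelings {α T : Type*} [Fintype α] [DecidableEq α] [Fintype T]
    (σ : Equiv.Perm α) (u v : T → ℂ) :
    (∑ f : α → T, open Classical in if ∀ i, f (σ i) = f i then
        ∏ i, (if σ i = i then u (f i) else v (f i)) else 0) =
      (σ.partition.parts.map fun k => if k = 1 then ∑ t, u t else ∑ t, v t ^ k).prod := by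
  classical
  rw [← prod_sameCycle_card]
  set mk : α → Quotient (Equiv.Perm.SameCycle.setoid σ) := Quotient.mk _ with hmk
  have mk_eq : ∀ i j, mk i = mk j ↔ σ.SameCycle i j := fun i j => Quotient.eq
  have mk_apply : ∀ i, mk (σ i) = mk i := fun i =>
    (mk_eq _ _).2 (Equiv.Perm.sameCycle_apply_left.2 (Equiv.Perm.SameCycle.refl _ _))
  have hsurj : Function.Surjective mk := Quotient.mk_surjective
  have hinv : ∀ f : α → T, (∀ i, f (σ i) = f i) → ∀ i j, σ.SameCycle i j → f i = f j := by
    intro f hf i j hij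
    have hpow : ∀ (k : ℕ) i, f ((σ ^ k) i) = f i := by
      intro k
      induction k with
      | zero => intro i; rfl
      | succ k ih => intro i; rw [pow_succ, Equiv.Perm.mul_apply, ih, hf]
    obtain ⟨k, rfl⟩ := hij.exists_nat_pow_eq
    exact (hpow k i).symm
  -- An invariant labeling is a labeling of the set of cycles, so its sum factors over the cycles.
  calc _ = ∑ g : Quotient (Equiv.Perm.SameCycle.setoid σ) → T,
        ∏ i, (if σ i = i then u (g (mk i)) else v (g (mk i))) := by
        symm
        refine Fintype.sum_of_injective (fun g => g ∘ mk) hsurj.injective_comp_right _ _ ?_ ?_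
        · intro f hf
          rw [if_neg]
          intro h
          refine hf ⟨fun q => f q.out, funext fun i => hinv f h _ _ ?_⟩
          exact (mk_eq _ _).1 (Quotient.out_eq _)
        · intro g
          rw [if_pos (fun i => by simp only [Function.comp_apply, mk_apply])]
          rfl
    _ = ∑ g : Quotient (Equiv.Perm.SameCycle.setoid σ) → T,
        ∏ q, ∏ i ∈ Finset.univ.filter (fun i => mk i = q),
          (if σ i = i then u (g q) else v (g q)) := by
        refine Finset.sum_congr rfl fun g _ => ?_
        rw [← Finset.prod_fiberwise Finset.univ mk]
        refine Finset.prod_congr rfl fun q _ => Finset.prod_congr rfl fun i hi => ?_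
        rw [(Finset.mem_filter.1 hi).2]
    _ = ∏ q, ∑ t, ∏ i ∈ Finset.univ.filter (fun i => mk i = q),
          (if σ i = i then u t else v t) := by
        rw [Finset.prod_univ_sum, Fintype.piFinset_univ]
    _ = _ := by
        refine Finset.prod_congr rfl fun q _ => ?_
        obtain ⟨i, rfl⟩ := hsurj q
        by_cases hi : σ i = i
        · have : Finset.univ.filter (fun j => mk j = mk i) = {i} := by
            ext j
            simp only [Finset.mem_filter, Finset.mem_univ, true_and, Finset.mem_singleton, mk_eq]
            refine ⟨fun h => ((Equiv.Perm.sameCycle_comm.1 h).eq_of_left hi).symm,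
              fun h => h ▸ Equiv.Perm.SameCycle.refl _ _⟩
          rw [this]
          simp [hi]
        · have hne : (Finset.univ.filter (fun j => mk j = mk i)).card ≠ 1 := by
            intro h
            have := Finset.card_le_one.1 h.le (σ i) (by simp [mk_apply]) i (by simp)
            exact hi this
          rw [if_neg hne]
          refine Finset.sum_congr rfl fun t _ => ?_
          rw [Finset.prod_congr rfl (g := fun _ => v t), Finset.prod_const]
          intro j hj
          rw [if_neg]
          intro h
          have := ((mk_eq _ _).1 (Finset.mem_filter.1 hj).2).eq_of_left h
          exact hi (this ▸ h)

/-- The product over the cycle lengths, weighted by the cycle counts. -/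
theorem prod_pow_cycleCount {n : ℕ} (σ : Equiv.Perm (Fin n)) (z : ℕ → ℂ) :
    ∏ k ∈ Finset.Icc 1 n, z k ^ cycleCount σ k = (σ.partition.parts.map z).prod := by
  rw [Finset.prod_multiset_map_count]
  symm
  refine Finset.prod_subset ?_ ?_
  · intro k hk
    have hk' := Multiset.mem_toFinset.1 hk
    have h1 := σ.partition.parts_pos hk'
    have h2 := Multiset.le_sum_of_mem hk'
    rw [σ.partition.parts_sum, Fintype.card_fin] at h2
    exact Finset.mem_Icc.2 ⟨h1, h2⟩
  · intro k _ hk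
    rw [Multiset.count_eq_zero_of_notMem (fun h => hk (Multiset.mem_toFinset.2 h)), pow_zero]

/-! ### Partition sums on the complete bipartite graph and changes of alphabet. -/

/-- The partition sum of a normal factor graph on the complete bipartite graph, with vertex
functions `L`, `R` and edge kernels `k`, where the two ends of an edge may have different
alphabets. -/
def latticeSum {n : ℕ} {A B : Type*} [Fintype A] [Fintype B] (L : (Fin n → A) → ℂ)
    (R : (Fin n → B) → ℂ) (k : Fin n → Fin n → A → B → ℂ) : ℂ :=
  ∑ x : Fin n → Fin n → A, ∑ y : Fin n → Fin n → B,
    (∏ i, L (x i)) * (∏ i, ∏ j, k i j (x i j) (y i j)) * ∏ j, R (fun i => y i j)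

section latticeSum

variable {n : ℕ} {A A' B B' : Type*} [Fintype A] [Fintype A'] [Fintype B] [Fintype B']

/-- Exchanging the two sides of the graph. -/
theorem latticeSum_flip (L : (Fin n → A) → ℂ) (R : (Fin n → B) → ℂ)
    (k : Fin n → Fin n → A → B → ℂ) :
    latticeSum L R k = latticeSum R L (fun j i b a => k i j a b) := by
  unfold latticeSum
  rw [Finset.sum_comm, ← (Equiv.piComm fun (_ _ : Fin n) => B).sum_comp]
  refine Finset.sum_congr rfl fun y _ => ?_
  rw [← (Equiv.piComm fun (_ _ : Fin n) => A).sum_comp]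
  refine Finset.sum_congr rfl fun x _ => ?_
  have hx : (Equiv.piComm fun _ _ => A) x = fun i j => x j i := rfl
  have hy : (Equiv.piComm fun _ _ => B) y = fun i j => y j i := rfl
  rw [hx, hy, Finset.prod_comm]
  ring

/-- The sum over the variables of the left vertices splits into a product over these vertices. -/
theorem latticeSum_eq_sum_prod (L : (Fin n → A) → ℂ) (R : (Fin n → B) → ℂ)
    (k : Fin n → Fin n → A → B → ℂ) :
    latticeSum L R k = ∑ y : Fin n → Fin n → B,
      (∏ i, ∑ x : Fin n → A, L x * ∏ j, k i j (x j) (y i j)) * ∏ j, R (fun i => y i j) := by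
  unfold latticeSum
  rw [Finset.sum_comm]
  refine Finset.sum_congr rfl fun y _ => ?_
  rw [Finset.prod_univ_sum, Fintype.piFinset_univ, Finset.sum_mul]
  refine Finset.sum_congr rfl fun x _ => ?_
  rw [Finset.prod_mul_distrib]

/-- For fixed right variables the left vertices do not interact, so a change of alphabet at the left
ends can be checked at a single vertex. -/
theorem latticeSum_congr_left {L : (Fin n → A) → ℂ} {L' : (Fin n → A') → ℂ}
    (R : (Fin n → B) → ℂ) {k : Fin n → Fin n → A → B → ℂ} {k' : Fin n → Fin n → A' → B → ℂ}
    (h : ∀ i (y : Fin n → B), ∑ x, L x * ∏ j, k i j (x j) (y j) =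
      ∑ x, L' x * ∏ j, k' i j (x j) (y j)) :
    latticeSum L R k = latticeSum L' R k' := by
  simp only [latticeSum_eq_sum_prod, h]

theorem latticeSum_congr_right (L : (Fin n → A) → ℂ) {R : (Fin n → B) → ℂ}
    {R' : (Fin n → B') → ℂ} {k : Fin n → Fin n → A → B → ℂ} {k' : Fin n → Fin n → A → B' → ℂ}
    (h : ∀ j (x : Fin n → A), ∑ y, R y * ∏ i, k i j (x i) (y i) =
      ∑ y, R' y * ∏ i, k' i j (x i) (y i)) :
    latticeSum L R k = latticeSum L R' k' := by
  rw [latticeSum_flip, latticeSum_flip L]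
  exact latticeSum_congr_left _ h

/-- An edge kernel supported on the diagonal. -/
theorem latticeSum_diag [DecidableEq A] (L R : (Fin n → A) → ℂ) (w : Fin n → Fin n → A → ℂ) :
    latticeSum L R (fun i j a b => if a = b then w i j a else 0) =
      ∑ x : Fin n → Fin n → A,
        (∏ i, L (x i)) * (∏ i, ∏ j, w i j (x i j)) * ∏ j, R (fun i => x i j) := by
  unfold latticeSum
  refine Finset.sum_congr rfl fun x _ => ?_
  rw [Finset.sum_eq_single x]
  · simp
  · intro y _ hy
    obtain ⟨i, hi⟩ := Function.ne_iff.1 hy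
    obtain ⟨j, hj⟩ := Function.ne_iff.1 hi
    have : ∏ i, ∏ j, (if x i j = y i j then w i j (x i j) else 0) = 0 := by
      refine Finset.prod_eq_zero (Finset.mem_univ i) (Finset.prod_eq_zero (Finset.mem_univ j) ?_)
      rw [if_neg (fun h => hj h.symm)]
    rw [this]
    ring
  · simp

end latticeSum

/-! ### Paired edge states and their expansion over pairs of permutations. -/

/-- The edge states in which the two copies of `θ` and the two copies of its conjugate pair up:
none or all of the four are present, or one of two complementary pairs of type `t`. -/
inductive PairState (T : Type) : Type
  | zero : PairState T
  | one : PairState T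
  | pos : T → PairState T
  | neg : T → PairState T
  deriving DecidableEq, Fintype

namespace PairState

variable {n : ℕ} {T : Type}

/-- The states around a vertex whose two chosen edges are `p` and `q`. -/
def row (p q : Fin n) (t : T) (j : Fin n) : PairState T :=
  if p = j then (if q = j then one else pos t) else if q = j then neg t else zero

theorem row_self (p : Fin n) (t : T) :
    row p p t = fun j => if p = j then one else zero := by
  funext j
  by_cases h : p = j <;> simp [row, h]

/-- The normalization of the states around a vertex: if the two chosen edges coincide, then the
type is irrelevant. -/
def rowCoeff (T : Type) [Fintype T] (p q : Fin n) : ℂ :=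
  if p = q then (Fintype.card T : ℂ)⁻¹ else 1

variable [Fintype T] [DecidableEq T]

/-- The indicator function of the sets of states `row p q t`. -/
def vertexFun (x : Fin n → PairState T) : ℂ :=
  ∑ d : Fin n × Fin n × T, if x = row d.1 d.2.1 d.2.2 then rowCoeff T d.1 d.2.1 else 0

theorem sum_vertexFun_mul (F : (Fin n → PairState T) → ℂ) :
    ∑ x, vertexFun x * F x =
      ∑ d : Fin n × Fin n × T, rowCoeff T d.1 d.2.1 * F (row d.1 d.2.1 d.2.2) := by
  simp only [vertexFun, Finset.sum_mul]
  rw [Finset.sum_comm]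
  refine Finset.sum_congr rfl fun d _ => ?_
  simp [ite_mul]

/-- The states around a vertex, split according to whether the two chosen edges coincide. -/
theorem sum_vertexFun_mul_prod [Nonempty T] (G : Fin n → PairState T → ℂ) :
    ∑ x, vertexFun x * ∏ j, G j (x j) =
      ∑ p, ∑ q, if p = q then ∏ j, G j (if p = j then one else zero) else
        (∑ t, G p (pos t) * G q (neg t)) *
          ∏ j ∈ (Finset.univ.erase p).erase q, G j zero := by
  rw [sum_vertexFun_mul (fun x => ∏ j, G j (x j)), Fintype.sum_prod_type]
  refine Finset.sum_congr rfl fun p _ => ?_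
  rw [Fintype.sum_prod_type]
  refine Finset.sum_congr rfl fun q _ => ?_
  by_cases h : p = q
  · subst h
    -- All types give the same row here, and their weights `(card T)⁻¹` add up to 1.
    simp only [rowCoeff, if_true, row_self]
    rw [Finset.sum_const, Finset.card_univ, nsmul_eq_mul, mul_inv_cancel_left₀]
    exact_mod_cast Fintype.card_ne_zero
  · simp only [rowCoeff, if_neg h, one_mul]
    rw [Finset.sum_mul]
    refine Finset.sum_congr rfl fun t _ => ?_
    rw [← Finset.mul_prod_erase Finset.univ _ (Finset.mem_univ p),
      ← Finset.mul_prod_erase (Finset.univ.erase p) _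
        (Finset.mem_erase.2 ⟨fun e => h e.symm, Finset.mem_univ q⟩), mul_assoc]
    congr 1
    · simp [row, Ne.symm h]
    congr 1
    · simp [row, h]
    refine Finset.prod_congr rfl fun j hj => ?_
    have h1 : q ≠ j := fun e => by simp [e] at hj
    have h2 : p ≠ j := fun e => by simp [e] at hj
    simp [row, h1, h2]

/-- The states around a right vertex `j`, if the left vertex `i` has chosen the edges `σ i`
and `o i`. -/
theorem vertexFun_column_of_perm [Nonempty T] (σ o : Equiv.Perm (Fin n)) (f : Fin n → T)
    (j : Fin n) :
    vertexFun (fun i => row (σ i) (o i) (f i) j) =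
      if f (σ.symm j) = f (o.symm j) then 1 else 0 := by
  -- In column `j` only the left vertices `σ⁻¹ j` and `o⁻¹ j` have a state other than `zero`. If
  -- they differ they carry `pos` and `neg`, whose types must agree; if they coincide the state is
  -- `one` and the type is unconstrained.
  have key : ∀ p q t, ((fun i => row (σ i) (o i) (f i) j) = row p q t) ↔
      p = σ.symm j ∧ q = o.symm j ∧ (p ≠ q → f p = t ∧ f q = t) := by
    intro p q t
    constructor
    · intro h
      have h1 : p = σ.symm j := by
        have := congrFun h p
        rw [Equiv.eq_symm_apply]
        by_contra h'
        simp only [row, if_neg h', if_true] at this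
        split_ifs at this
      have h2 : q = o.symm j := by
        have := congrFun h q
        rw [Equiv.eq_symm_apply]
        by_contra h'
        simp only [row, if_neg h', if_true] at this
        split_ifs at this
      refine ⟨h1, h2, fun hpq => ?_⟩
      have e1 : σ p = j := by rw [h1]; simp
      have e2 : o q = j := by rw [h2]; simp
      have e3 : o p ≠ j := fun h => hpq (o.injective (h.trans e2.symm))
      have e4 : σ q ≠ j := fun h => hpq (σ.injective (e1.trans h.symm))
      have a := congrFun h p
      have b := congrFun h q
      simp [row, e1, e3, Ne.symm hpq] at a
      simp [row, e2, e4, hpq] at b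
      exact ⟨a, b⟩
    · rintro ⟨rfl, rfl, h⟩
      funext i
      have e1 : ∀ i, σ.symm j = i ↔ σ i = j := fun i => by
        rw [Equiv.symm_apply_eq, eq_comm]
      have e2 : ∀ i, o.symm j = i ↔ o i = j := fun i => by
        rw [Equiv.symm_apply_eq, eq_comm]
      simp only [row, e1, e2]
      by_cases a : σ i = j <;> by_cases b : o i = j
      · simp [a, b]
      · have hi := (e1 i).2 a
        have := h (fun e => b ((e2 i).1 (e ▸ hi)))
        rw [hi] at this
        simp [a, b, this.1]
      · have hi := (e2 i).2 b
        have := h (fun e => a ((e1 i).1 (e.trans hi)))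
        rw [hi] at this
        simp [a, b, this.2]
      · simp [a, b]
  unfold vertexFun
  simp only [key]
  rw [Fintype.sum_prod_type, Finset.sum_eq_single (σ.symm j) _ (by simp)]
  swap
  · intro p _ hp
    exact Finset.sum_eq_zero fun d _ => if_neg (fun h => hp h.1)
  rw [Fintype.sum_prod_type, Finset.sum_eq_single (o.symm j) _ (by simp)]
  swap
  · intro q _ hq
    exact Finset.sum_eq_zero fun t _ => if_neg (fun h => hq h.2.1)
  by_cases h : σ.symm j = o.symm j
  · have hT : (Fintype.card T : ℂ) ≠ 0 := by exact_mod_cast Fintype.card_ne_zero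
    simp [h, rowCoeff, hT]
  · simp only [ne_eq, h, not_false_eq_true, true_and, forall_const, rowCoeff, if_false]
    by_cases h' : f (σ.symm j) = f (o.symm j)
    · simp [h']
    · rw [if_neg h']
      exact Finset.sum_eq_zero fun t _ => if_neg (fun e => h' (e.1.trans e.2.symm))

/-- A `row p q t` has `pos` or `one` at `p` and `neg` or `one` at `q`. A nonzero value at every `j`
thus makes `σ` and `o` surjective, hence bijective. -/
theorem exists_vertexFun_column_eq_zero (σ o : Fin n → Fin n) (f : Fin n → T)
    (h : ¬ (Function.Bijective σ ∧ Function.Bijective o)) :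
    ∃ j, vertexFun (fun i => row (σ i) (o i) (f i) j) = 0 := by
  by_contra! H
  have key : ∀ j, ∃ p q t, (fun i => row (σ i) (o i) (f i) j) = row p q t := by
    intro j
    obtain ⟨d, -, hd⟩ := Finset.exists_ne_zero_of_sum_ne_zero (H j)
    refine ⟨d.1, d.2.1, d.2.2, ?_⟩
    by_contra hne
    exact hd (if_neg hne)
  refine h ⟨Finite.surjective_iff_bijective.1 fun j => ?_,
    Finite.surjective_iff_bijective.1 fun j => ?_⟩
  · obtain ⟨p, q, t, e⟩ := key j
    refine ⟨p, ?_⟩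
    have := congrFun e p
    by_contra h'
    simp only [row, if_neg h', if_true] at this
    split_ifs at this
  · obtain ⟨p, q, t, e⟩ := key j
    refine ⟨q, ?_⟩
    have := congrFun e q
    by_contra h'
    simp only [row, if_neg h', if_true] at this
    split_ifs at this

end PairState

theorem sum_eq_sum_perm {n : ℕ} (F : (Fin n → Fin n) → ℂ)
    (hF : ∀ σ, ¬ Function.Bijective σ → F σ = 0) :
    ∑ σ, F σ = ∑ σ : Equiv.Perm (Fin n), F σ := by
  symm
  refine Fintype.sum_of_injective (fun σ : Equiv.Perm (Fin n) => (σ : Fin n → Fin n))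
    DFunLike.coe_injective _ _ ?_ (fun _ => rfl)
  intro σ hσ
  exact hF σ fun h => hσ ⟨Equiv.ofBijective σ h, rfl⟩

open PairState in
/-- The weights of the edges around a left vertex. -/
theorem prod_row_weight {n : ℕ} {T : Type} (w : PairState T → ℂ) (h0 : w zero = 1)
    (p q : Fin n) (t : T) :
    ∏ j, w (row p q t j) = if p = q then w one else w (pos t) * w (neg t) := by
  by_cases h : p = q
  · subst h
    rw [row_self, if_pos rfl, Finset.prod_eq_single p]
    · simp
    · intro j _ hj
      simp [Ne.symm hj, h0]
    · simp
  · rw [if_neg h, ← Finset.mul_prod_erase Finset.univ _ (Finset.mem_univ p),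
      ← Finset.mul_prod_erase (Finset.univ.erase p) _
        (Finset.mem_erase.2 ⟨fun e => h e.symm, Finset.mem_univ q⟩), Finset.prod_eq_one, mul_one]
    · simp [row, h, Ne.symm h]
    · intro j hj
      have h1 : q ≠ j := fun e => by simp [e] at hj
      have h2 : p ≠ j := fun e => by simp [e] at hj
      simp [row, h1, h2, h0]

open PairState in
/-- The partition sum with paired edge states is a sum over pairs of permutations, where each
cycle of their quotient has a type. -/
theorem latticeSum_vertexFun {n : ℕ} {T : Type} [Fintype T] [DecidableEq T] [Nonempty T]
    (w : PairState T → ℂ) (h0 : w zero = 1) :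
    latticeSum (n := n) vertexFun vertexFun (fun _ _ a b => if a = b then w a else 0) =
      (n ! : ℂ) * ∑ σ : Equiv.Perm (Fin n), ∏ k ∈ Finset.Icc 1 n,
        (if k = 1 then w one else ∑ t, (w (pos t) * w (neg t)) ^ k) ^ cycleCount σ k := by
  rw [latticeSum_diag]
  have hT : (Fintype.card T : ℂ) ≠ 0 := by exact_mod_cast Fintype.card_ne_zero
  -- The normalization of the left vertices is absorbed into `c`; it cancels when the types of the
  -- fixed points are summed.
  set c : Fin n → Fin n → T → ℂ := fun p q t =>
    if p = q then (Fintype.card T : ℂ)⁻¹ * w one else w (pos t) * w (neg t) with hc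
  calc _ = ∑ D : Fin n → Fin n × Fin n × T,
        (∏ i, c (D i).1 (D i).2.1 (D i).2.2) *
          ∏ j, vertexFun (fun i => row (D i).1 (D i).2.1 (D i).2.2 j) := by
        have : ∀ x : Fin n → Fin n → PairState T, ∏ i, vertexFun (x i) =
            ∑ D : Fin n → Fin n × Fin n × T, ∏ i, if x i = row (D i).1 (D i).2.1 (D i).2.2
              then rowCoeff T (D i).1 (D i).2.1 else 0 := by
          intro x
          simp only [vertexFun]
          rw [Finset.prod_univ_sum, Fintype.piFinset_univ]
        simp only [this, Finset.sum_mul]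
        rw [Finset.sum_comm]
        refine Finset.sum_congr rfl fun D _ => ?_
        rw [Finset.sum_eq_single (fun i => row (D i).1 (D i).2.1 (D i).2.2)]
        · simp only [if_true]
          rw [← Finset.prod_mul_distrib]
          congr 1
          refine Finset.prod_congr rfl fun i _ => ?_
          rw [prod_row_weight w h0, hc, rowCoeff]
          by_cases h : (D i).1 = (D i).2.1 <;> simp [h]
        · intro x _ hx
          obtain ⟨i, hi⟩ := Function.ne_iff.1 hx
          rw [Finset.prod_eq_zero (Finset.mem_univ i) (if_neg hi)]
          ring
        · simp
    _ = ∑ σ : Fin n → Fin n, ∑ o : Fin n → Fin n, ∑ f : Fin n → T,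
          (∏ i, c (σ i) (o i) (f i)) * ∏ j, vertexFun (fun i => row (σ i) (o i) (f i) j) := by
        rw [← (Equiv.arrowProdEquivProdArrow (Fin n) (fun _ => Fin n)
          (fun _ => Fin n × T)).symm.sum_comp, Fintype.sum_prod_type]
        refine Finset.sum_congr rfl fun σ _ => ?_
        rw [← (Equiv.arrowProdEquivProdArrow (Fin n) (fun _ => Fin n)
          (fun _ => T)).symm.sum_comp, Fintype.sum_prod_type]
        rfl
    _ = ∑ σ : Equiv.Perm (Fin n), ∑ o : Equiv.Perm (Fin n), ∑ f : Fin n → T,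
          (∏ i, c (σ i) (o i) (f i)) * ∏ j, if f (σ.symm j) = f (o.symm j) then 1 else 0 := by
        have hz : ∀ (σ o : Fin n → Fin n) (f : Fin n → T),
            ¬ (Function.Bijective σ ∧ Function.Bijective o) → (∏ i, c (σ i) (o i) (f i)) *
              ∏ j, vertexFun (fun i => row (σ i) (o i) (f i) j) = 0 := by
          intro σ o f h
          obtain ⟨j, hj⟩ := exists_vertexFun_column_eq_zero σ o f h
          exact mul_eq_zero_of_right _ (Finset.prod_eq_zero (Finset.mem_univ j) hj)
        rw [sum_eq_sum_perm]
        · refine Finset.sum_congr rfl fun σ _ => ?_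
          rw [sum_eq_sum_perm]
          · simp only [vertexFun_column_of_perm]
          · intro o ho
            exact Finset.sum_eq_zero fun f _ => hz _ _ _ fun h => ho h.2
        · intro σ hσ
          exact Finset.sum_eq_zero fun o _ => Finset.sum_eq_zero fun f _ =>
            hz _ _ _ fun h => hσ h.1
    _ = ∑ σ : Equiv.Perm (Fin n), ∑ π : Equiv.Perm (Fin n), ∑ f : Fin n → T,
          if ∀ i, f (π i) = f i then
            ∏ i, (if π i = i then (Fintype.card T : ℂ)⁻¹ * w one else w (pos (f i)) * w (neg (f i)))
          else 0 := by
        refine Finset.sum_congr rfl fun σ _ => ?_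
        -- Substitute `o = σ * π`. The condition at `j = o i` compares the types at `π i` and `i`,
        -- so `σ` drops out of the summand.
        rw [← Equiv.sum_comp (Equiv.mulLeft σ)]
        refine Finset.sum_congr rfl fun π _ => Finset.sum_congr rfl fun f _ => ?_
        rw [Finset.prod_ite_zero]
        have : (∀ j ∈ Finset.univ, f (σ.symm j) = f ((Equiv.mulLeft σ π).symm j)) ↔
            ∀ i, f (π i) = f i := by
          have e : ∀ i, σ.symm ((Equiv.mulLeft σ π) i) = π i := fun i => σ.symm_apply_apply _
          rw [← (Equiv.mulLeft σ π).forall_congr_right]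
          simp only [Finset.mem_univ, true_imp_iff, Equiv.symm_apply_apply, e]
        simp only [this]
        by_cases h : ∀ i, f (π i) = f i
        · simp only [if_pos h, Finset.prod_const_one, mul_one, hc]
          refine Finset.prod_congr rfl fun i _ => ?_
          simp [Equiv.Perm.mul_apply, eq_comm (a := i)]
        · simp only [if_neg h, mul_zero]
    _ = _ := by
        rw [Finset.sum_const, Finset.card_univ, Fintype.card_perm, Fintype.card_fin,
          nsmul_eq_mul]
        congr 1
        refine Finset.sum_congr rfl fun π _ => ?_
        rw [prod_pow_cycleCount]
        have := sum_invariant_labelings π (fun _ : T => (Fintype.card T : ℂ)⁻¹ * w one)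
          (fun t => w (pos t) * w (neg t))
        rw [Finset.sum_const, Finset.card_univ, nsmul_eq_mul, mul_inv_cancel_left₀ hT] at this
        rw [← this]
        refine Finset.sum_congr rfl fun f _ => ?_
        congr

/-! ### Reduction of the check nodes to pairings. -/

theorem checkNode_eq_sum {n : ℕ} (x : Fin n → Fin 2) :
    checkNode x = ∑ a, if x = fun j => if j = a then 1 else 0 then 1 else 0 := by
  have h01 : ∀ b : Fin 2, b ≠ 1 → b = 0 := by decide
  have key : ∀ a, (x = fun j => if j = a then 1 else 0) ↔ x a = 1 ∧ ∀ j, x j = 1 → j = a := by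
    intro a
    constructor
    · rintro rfl
      simp
    · rintro ⟨h1, h2⟩
      funext j
      by_cases h : j = a
      · simp [h, h1]
      · simpa [h] using h01 _ fun e => h (h2 j e)
  unfold checkNode
  split_ifs with h
  · obtain ⟨a, ha, h'⟩ := h
    rw [Finset.sum_eq_single a, if_pos ((key a).2 ⟨ha, h'⟩)]
    · intro b _ hb
      exact if_neg fun e => hb (h' b ((key b).1 e).1)
    · simp
  · symm
    exact Finset.sum_eq_zero fun a _ => if_neg fun e => h ⟨a, (key a).1 e⟩

/-- The function of a vertex in a `2`-cover of a double-edge normal factor graph, on the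
variables of both of its copies. -/
def checkPair {n : ℕ} (x : Fin n → Fin 2 → Fin 2 × Fin 2) : ℂ :=
  ∏ m, checkNode (fun j => (x j m).1) * checkNode (fun j => (x j m).2)

/-- The states around the copies of a vertex whose four check nodes choose the edges
`a`, `b`, `c`, `d`. -/
def chosen {n : ℕ} (a b c d j : Fin n) : Fin 2 → Fin 2 × Fin 2 :=
  ![(if j = a then 1 else 0, if j = b then 1 else 0),
    (if j = c then 1 else 0, if j = d then 1 else 0)]

/-- Each of the four check nodes selects one edge: `a` and `c` for the unprimed bits of the copies 0
and 1, `b` and `d` for the primed bits. -/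
theorem sum_checkPair_mul {n : ℕ} (F : (Fin n → Fin 2 → Fin 2 × Fin 2) → ℂ) :
    ∑ x, checkPair x * F x = ∑ a, ∑ b, ∑ c, ∑ d, F (chosen a b c d) := by
  have key : ∀ x : Fin n → Fin 2 → Fin 2 × Fin 2, checkPair x =
      ∑ a, ∑ b, ∑ c, ∑ d, if x = chosen a b c d then 1 else 0 := by
    intro x
    unfold checkPair
    rw [Fin.prod_univ_two]
    simp only [checkNode_eq_sum, Finset.sum_mul_sum]
    refine Finset.sum_congr rfl fun a _ => ?_
    rw [Finset.sum_comm]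
    refine Finset.sum_congr rfl fun b _ => Finset.sum_congr rfl fun c _ =>
      Finset.sum_congr rfl fun d _ => ?_
    have : x = chosen a b c d ↔ (((fun j => (x j 0).1) = fun j => if j = a then 1 else 0) ∧
        ((fun j => (x j 0).2) = fun j => if j = b then 1 else 0)) ∧
        (((fun j => (x j 1).1) = fun j => if j = c then 1 else 0) ∧
        ((fun j => (x j 1).2) = fun j => if j = d then 1 else 0)) := by
      constructor
      · rintro rfl
        exact ⟨⟨rfl, rfl⟩, rfl, rfl⟩
      · rintro ⟨⟨h1, h2⟩, h3, h4⟩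
        funext j m
        fin_cases m
        · exact Prod.ext (congrFun h1 j) (congrFun h2 j)
        · exact Prod.ext (congrFun h3 j) (congrFun h4 j)
    simp only [this, ite_and, mul_ite, mul_one, mul_zero]
    split_ifs <;> rfl
  simp only [key, Finset.sum_mul]
  rw [Finset.sum_comm]
  refine Finset.sum_congr rfl fun a _ => ?_
  rw [Finset.sum_comm]
  refine Finset.sum_congr rfl fun b _ => ?_
  rw [Finset.sum_comm]
  refine Finset.sum_congr rfl fun c _ => ?_
  rw [Finset.sum_comm]
  refine Finset.sum_congr rfl fun d _ => ?_
  simp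

namespace PairState

/-- The states with an even number of ones in which the four bits pair up. -/
def bits : PairState (Fin 3) → Fin 2 → Fin 2 × Fin 2
  | zero => ![(0, 0), (0, 0)]
  | one => ![(1, 1), (1, 1)]
  | pos t => ![![(1, 1), (0, 0)], ![(1, 0), (0, 1)], ![(1, 0), (1, 0)]] t
  | neg t => ![![(0, 0), (1, 1)], ![(0, 1), (1, 0)], ![(0, 1), (0, 1)]] t

theorem bits_inj : ∀ a b : PairState (Fin 3), a.bits = b.bits ↔ a = b := by
  decide

/-- Type 0 pairs unprimed with primed inside a copy, type 1 pairs them across the copies, and type 2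
pairs equal kinds across the copies. -/
theorem bits_row {n : ℕ} (p q : Fin n) :
    (fun j => bits (row p q 0 j)) = chosen p p q q ∧
    (fun j => bits (row p q 1 j)) = chosen p q q p ∧
    (fun j => bits (row p q 2 j)) = chosen p q p q := by
  refine ⟨?_, ?_, ?_⟩ <;>
  · funext j
    by_cases h1 : p = j <;> by_cases h2 : q = j <;>
      simp [row, chosen, bits, h1, h2, eq_comm (a := j)]

end PairState

/-- The number of ones among the unprimed, respectively the primed, bits of a state. -/
def bitDegree (x : Fin 2 → Fin 2 × Fin 2) : ℕ × ℕ :=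
  ((x 0).1 + (x 1).1, (x 0).2 + (x 1).2)

open PairState in
/-- If no edge can carry exactly one of the four bits, then the bits around a vertex pair up. -/
theorem sum_checkPair_mul_prod {n : ℕ} (G : Fin n → (Fin 2 → Fin 2 × Fin 2) → ℂ)
    (hG : ∀ j x, (bitDegree x).1 + (bitDegree x).2 = 1 → G j x = 0) :
    ∑ x, checkPair x * ∏ j, G j (x j) =
      ∑ y : Fin n → PairState (Fin 3), vertexFun y * ∏ j, G j (bits (y j)) := by
  rw [sum_checkPair_mul (fun x => ∏ j, G j (x j)),
    sum_vertexFun_mul (fun y : Fin n → PairState (Fin 3) => ∏ j, G j (bits (y j)))]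
  set H : Fin n → Fin n → Fin n → Fin n → ℂ := fun a b c d => ∏ j, G j (chosen a b c d j) with hH
  have hz : ∀ a b c d j, (bitDegree (chosen a b c d j)).1 + (bitDegree (chosen a b c d j)).2 = 1 →
      H a b c d = 0 := fun a b c d j h => Finset.prod_eq_zero (Finset.mem_univ j) (hG _ _ h)
  have ha : ∀ a b c d, b ≠ a → c ≠ a → d ≠ a → H a b c d = 0 := fun a b c d h1 h2 h3 =>
    hz a b c d a (by simp [bitDegree, chosen, h1.symm, h2.symm, h3.symm])
  have hb : ∀ a b c d, a ≠ b → c ≠ b → d ≠ b → H a b c d = 0 := fun a b c d h1 h2 h3 =>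
    hz a b c d b (by simp [bitDegree, chosen, h1.symm, h2.symm, h3.symm])
  have hc : ∀ a b c d, a ≠ c → b ≠ c → d ≠ c → H a b c d = 0 := fun a b c d h1 h2 h3 =>
    hz a b c d c (by simp [bitDegree, chosen, h1.symm, h2.symm, h3.symm])
  have hd : ∀ a b c d, a ≠ d → b ≠ d → c ≠ d → H a b c d = 0 := fun a b c d h1 h2 h3 =>
    hz a b c d d (by simp [bitDegree, chosen, h1.symm, h2.symm, h3.symm])
  -- Every edge must be selected at least twice. Two of the three pairings hold simultaneously only
  -- if all four edges agree; then all three hold, with weight 1/3 each.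
  have split : ∀ a b c d, H a b c d =
      (if b = a then if d = c then rowCoeff (Fin 3) a c * H a a c c else 0 else 0) +
      (if d = a then if c = b then rowCoeff (Fin 3) a b * H a b b a else 0 else 0) +
      (if c = a then if d = b then rowCoeff (Fin 3) a b * H a b a b else 0 else 0) := by
    intro a b c d
    by_cases e1 : b = a
    · subst e1
      by_cases e2 : d = c
      · subst e2
        by_cases e3 : d = b
        · subst e3
          simp [rowCoeff]
          ring
        · simp [rowCoeff, e3, Ne.symm e3]
      · rw [if_pos rfl, if_neg e2]
        by_cases e3 : d = b
        · subst e3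
          have : c ≠ d := Ne.symm e2
          rw [hc _ _ _ _ this.symm this.symm this.symm]
          simp [this]
        · rw [hd _ _ _ _ (Ne.symm e3) (Ne.symm e3) (Ne.symm e2)]
          simp [e3]
    · rw [if_neg e1, zero_add]
      by_cases e2 : d = a
      · subst e2
        rw [if_pos rfl, if_neg (Ne.symm e1)]
        by_cases e3 : c = b
        · subst e3
          simp [rowCoeff, Ne.symm e1]
        · rw [hb _ _ _ _ (Ne.symm e1) e3 (Ne.symm e1)]
          simp [e3]
      · rw [if_neg e2, zero_add]
        by_cases e3 : c = a
        · subst e3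
          rw [if_pos rfl]
          by_cases e4 : d = b
          · subst e4
            simp [rowCoeff, Ne.symm e1]
          · rw [if_neg e4, hb _ _ _ _ (Ne.symm e1) (Ne.symm e1) e4]
        · rw [if_neg e3, ha _ _ _ _ e1 e3 e2]
  have lhs : ∑ a, ∑ b, ∑ c, ∑ d, H a b c d =
      ∑ a, ∑ b, rowCoeff (Fin 3) a b * (H a a b b + H a b b a + H a b a b) := by
    refine (Finset.sum_congr rfl fun a _ => Finset.sum_congr rfl fun b _ =>
      Finset.sum_congr rfl fun c _ => Finset.sum_congr rfl fun d _ => split a b c d).trans ?_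
    simp only [Finset.sum_add_distrib, mul_add]
    refine congrArg₂ _ (congrArg₂ _ ?_ ?_) ?_ <;> refine Finset.sum_congr rfl fun a _ => ?_
    · rw [Finset.sum_eq_single a]
      · simp
      · intro b _ hb
        simp [hb]
      · simp
    · simp
    · refine Finset.sum_congr rfl fun b _ => ?_
      rw [Finset.sum_eq_single a]
      · simp
      · intro c _ hc
        simp [hc]
      · simp
  refine lhs.trans ?_
  rw [Fintype.sum_prod_type]
  refine Finset.sum_congr rfl fun p _ => ?_
  rw [Fintype.sum_prod_type]
  refine Finset.sum_congr rfl fun q _ => ?_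
  rw [Fin.sum_univ_three]
  obtain ⟨h0, h1, h2⟩ := bits_row p q
  simp only [congrFun h0, congrFun h1, congrFun h2, hH]
  ring

/-! ### Merging two pairings into one, and removal of unpaired states. -/

namespace PairState

/-- A change of basis under which two of the three pairings become one oriented pairing. -/
def lift (c : ℂ) (g : PairState (Fin 2) → ℂ) : PairState (Fin 3) → ℂ
  | zero => g zero
  | one => g one
  | pos t => ![(g (pos 0) + g (neg 0)) / 2, c * (g (pos 0) - g (neg 0)) / 2, g (pos 1)] t
  | neg t => ![(g (pos 0) + g (neg 0)) / 2, c * (g (pos 0) - g (neg 0)) / 2, g (neg 1)] t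

/-- With `c² = -1`, types 0 and 1 together give `(u_p v_q + v_p u_q) / 2`, where `u`, `v` are the
values at `pos 0`, `neg 0`. Summing over ordered pairs `(p, q)` undoes this symmetrization. -/
theorem sum_vertexFun_mul_prod_lift {n : ℕ} {c : ℂ} (hc : c ^ 2 = -1)
    (G : Fin n → PairState (Fin 2) → ℂ) :
    ∑ y : Fin n → PairState (Fin 3), vertexFun y * ∏ j, lift c (G j) (y j) =
      ∑ s : Fin n → PairState (Fin 2), vertexFun s * ∏ j, G j (s j) := by
  rw [sum_vertexFun_mul_prod, sum_vertexFun_mul_prod]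
  set r : Fin n → Fin n → ℂ := fun p q => ∏ j ∈ (Finset.univ.erase p).erase q, G j zero with hr
  have hrs : ∀ p q, r p q = r q p := fun p q => by rw [hr]; simp only [Finset.erase_right_comm]
  set A : Fin n → Fin n → ℂ := fun p q => if p = q then 0 else
    G p (pos 0) * G q (neg 0) * r p q with hA
  set D : Fin n → Fin n → ℂ := fun p q => if p = q then
      ∏ j, G j (if p = j then one else zero) else G p (pos 1) * G q (neg 1) * r p q with hD
  have h2 : ∀ p q, (if p = q then ∏ j, G j (if p = j then one else zero) else
      (∑ t, G p (pos t) * G q (neg t)) * r p q) = A p q + D p q := by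
    intro p q
    by_cases h : p = q
    · simp [hA, hD, h]
    · simp only [hA, hD, if_neg h, Fin.sum_univ_two]
      ring
  have hl : ∀ j (b : Prop) [Decidable b], lift c (G j) (if b then one else zero) =
      G j (if b then one else zero) := by
    intro j b _
    split_ifs <;> rfl
  have h3 : ∀ p q, (if p = q then ∏ j, lift c (G j) (if p = j then one else zero) else
      (∑ t, lift c (G p) (pos t) * lift c (G q) (neg t)) *
        ∏ j ∈ (Finset.univ.erase p).erase q, lift c (G j) zero) =
      (A p q + A q p) / 2 + D p q := by
    intro p q
    by_cases h : p = q
    · simp [hA, hD, h, hl]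
    · have h' : ¬ q = p := fun e => h e.symm
      simp only [hA, hD, if_neg h, if_neg h', Fin.sum_univ_three, hrs q p]
      have e0 : ∏ j ∈ (Finset.univ.erase p).erase q, lift c (G j) zero = r p q := rfl
      rw [e0]
      simp only [lift, Matrix.cons_val]
      linear_combination (G p (pos 0) - G p (neg 0)) * (G q (pos 0) - G q (neg 0)) * r p q / 4 * hc
  change _ = ∑ p, ∑ q, if p = q then ∏ j, G j (if p = j then one else zero) else
      (∑ t, G p (pos t) * G q (neg t)) * r p q
  simp only [h2, h3, Finset.sum_add_distrib, add_div, ← Finset.sum_div]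
  rw [Finset.sum_comm (f := fun p q => A q p)]
  ring

end PairState

open PairState in
/-- Only the paired states contribute to a partition sum whose kernel preserves the degrees and
vanishes on the states with exactly one bit. -/
theorem latticeSum_checkPair {n : ℕ} (κ : (Fin 2 → Fin 2 × Fin 2) → (Fin 2 → Fin 2 × Fin 2) → ℂ)
    (hκ : ∀ x y, κ x y ≠ 0 → bitDegree x = bitDegree y)
    (hκ1 : ∀ x y, (bitDegree x).1 + (bitDegree x).2 = 1 → κ x y = 0) :
    latticeSum (n := n) checkPair checkPair (fun _ _ x y => κ x y) =
      latticeSum (n := n) vertexFun vertexFun (fun _ _ a b => κ (bits a) (bits b)) := by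
  trans latticeSum (n := n) vertexFun checkPair (fun _ _ a y => κ (bits a) y)
  · exact latticeSum_congr_left _ fun i y =>
      sum_checkPair_mul_prod (fun j x => κ x (y j)) fun j x h => hκ1 x _ h
  -- The kernel is known to vanish for a left state with a single bit; preservation of degrees
  -- transfers this to the right state.
  · refine latticeSum_congr_right _ fun j x =>
      sum_checkPair_mul_prod (fun i y => κ (bits (x i)) y) fun i y h => ?_
    by_contra h'
    exact h' (hκ1 _ _ (hκ _ _ h' ▸ h))

-- Both constants square to `-1`, as the vertex identity needs, and their product is 1, so the
-- lifted kernel gets the sign of the symmetrizer on the states of type 1.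
open PairState in
theorem latticeSum_lift {n : ℕ} (k : PairState (Fin 2) → PairState (Fin 2) → ℂ) :
    latticeSum (n := n) vertexFun vertexFun
        (fun _ _ a b => lift Complex.I (fun s => lift (-Complex.I) (k s) b) a) =
      latticeSum (n := n) vertexFun vertexFun (fun _ _ a b => k a b) := by
  trans latticeSum (n := n) vertexFun vertexFun (fun _ _ s b => lift (-Complex.I) (k s) b)
  · exact latticeSum_congr_left _ fun i y =>
      sum_vertexFun_mul_prod_lift Complex.I_sq (fun j s => lift (-Complex.I) (k s) (y j))
  · exact latticeSum_congr_right _ fun j x =>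
      sum_vertexFun_mul_prod_lift (by rw [neg_sq, Complex.I_sq]) (fun i s => k (x i) s)

/-! ### Evaluation of the two moment sums. -/

/-- The moment that belongs to an edge in a given state. -/
def stateMoment (μ : ℕ → ℕ → ℂ) (x : Fin 2 → Fin 2 × Fin 2) : ℂ :=
  μ (bitDegree x).1 (bitDegree x).2

theorem bitDegree_eq_of_perm (x y : Fin 2 → Fin 2 × Fin 2) (π : Equiv.Perm (Fin 2))
    (h : x = y ∘ π) : bitDegree x = bitDegree y := by
  subst h
  have h1 := Equiv.sum_comp π (fun m => ((y m).1 : ℕ))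
  have h2 := Equiv.sum_comp π (fun m => ((y m).2 : ℕ))
  rw [Fin.sum_univ_two, Fin.sum_univ_two] at h1 h2
  unfold bitDegree
  exact Prod.ext h1 h2

theorem stateMoment_eq_zero {μ : ℕ → ℕ → ℂ} (h10 : μ 1 0 = 0) (h01 : μ 0 1 = 0)
    (x : Fin 2 → Fin 2 × Fin 2) (h : (bitDegree x).1 + (bitDegree x).2 = 1) :
    stateMoment μ x = 0 := by
  unfold stateMoment
  obtain ⟨h1, h2⟩ | ⟨h1, h2⟩ : ((bitDegree x).1 = 1 ∧ (bitDegree x).2 = 0) ∨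
    ((bitDegree x).1 = 0 ∧ (bitDegree x).2 = 1) := by omega
  · rw [h1, h2, h10]
  · rw [h1, h2, h01]

theorem latticeSum_moment_trivialCover {n : ℕ} (μ : ℕ → ℕ → ℂ) (h00 : μ 0 0 = 1)
    (h10 : μ 1 0 = 0) (h01 : μ 0 1 = 0) :
    latticeSum (n := n) checkPair checkPair
        (fun _ _ x y => (if x = y then 1 else 0) * stateMoment μ x) =
      (n ! : ℂ) * ∑ σ : Equiv.Perm (Fin n), ∏ k ∈ Finset.Icc 1 n,
        (if k = 1 then μ 2 2 else 2 * (μ 1 1 ^ 2) ^ k + (μ 2 0 * μ 0 2) ^ k) ^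
          cycleCount σ k := by
  rw [latticeSum_checkPair (fun x y => (if x = y then 1 else 0) * stateMoment μ x)]
  · have := latticeSum_vertexFun (n := n) (T := Fin 3) (fun a => stateMoment μ a.bits)
      (by simp [stateMoment, bitDegree, PairState.bits, h00])
    simp only [PairState.bits_inj, ite_mul, one_mul, zero_mul, this]
    simp only [Fin.sum_univ_three, stateMoment, bitDegree, PairState.bits]
    simp [sq, two_mul]
  · intro x y h
    by_cases e : x = y
    · rw [e]
    · simp [e] at h
  · intro x y h
    rw [stateMoment_eq_zero h10 h01 x h, mul_zero]

theorem latticeSum_moment_averageCover {n : ℕ} (μ : ℕ → ℕ → ℂ) (h00 : μ 0 0 = 1)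
    (h10 : μ 1 0 = 0) (h01 : μ 0 1 = 0) :
    latticeSum (n := n) checkPair checkPair (fun _ _ x y =>
        ((∑ π : Equiv.Perm (Fin 2), if x = y ∘ π then 1 else 0) / 2) * stateMoment μ x) =
      (n ! : ℂ) * ∑ σ : Equiv.Perm (Fin n), ∏ k ∈ Finset.Icc 1 n,
        (if k = 1 then μ 2 2 else (μ 1 1 ^ 2) ^ k + (μ 2 0 * μ 0 2) ^ k) ^ cycleCount σ k := by
  rw [latticeSum_checkPair (fun x y =>
    ((∑ π : Equiv.Perm (Fin 2), if x = y ∘ π then 1 else 0) / 2) * stateMoment μ x)]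
  · set w : PairState (Fin 2) → ℂ := fun s => match s with
      | .zero => 1
      | .one => μ 2 2
      | .pos t => ![μ 1 1, μ 2 0] t
      | .neg t => ![μ 1 1, μ 0 2] t with hw
    -- Swapping the copies exchanges `pos t` and `neg t` for `t = 0, 1` and fixes the states of type
    -- 2. On each exchanged pair the kernel is constant, equal to `μ 1 1 / 2`. The two lifts of the
    -- diagonal kernel `w` give the same, since `w` agrees at `pos 0` and `neg 0`.
    have hk : ∀ a b : PairState (Fin 3),
        ((∑ π : Equiv.Perm (Fin 2), if a.bits = b.bits ∘ π then (1 : ℂ) else 0) / 2) *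
          stateMoment μ a.bits =
        PairState.lift Complex.I (fun s => PairState.lift (-Complex.I)
          (fun s' => if s = s' then w s else 0) b) a := by
      have hπ : (Finset.univ : Finset (Equiv.Perm (Fin 2))) = {1, Equiv.swap 0 1} := by decide
      have hne : (1 : Equiv.Perm (Fin 2)) ≠ Equiv.swap 0 1 := by decide
      intro a b
      rw [hπ, Finset.sum_pair hne]
      have hb : ∀ b : PairState (Fin 3), b.bits ∘ Equiv.swap 0 1 = (match b with
        | .zero => .zero
        | .one => .one
        | .pos t => if t = 2 then .pos 2 else .neg t
        | .neg t => if t = 2 then .neg 2 else .pos t : PairState (Fin 3)).bits := by decide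
      have hs : ∀ a : PairState (Fin 3), stateMoment μ a.bits = match a with
        | .zero => 1
        | .one => μ 2 2
        | .pos t => ![μ 1 1, μ 1 1, μ 2 0] t
        | .neg t => ![μ 1 1, μ 1 1, μ 0 2] t := by
        rintro (_ | _ | t | t) <;> try fin_cases t
        all_goals simp [stateMoment, bitDegree, PairState.bits, h00]
      rw [hb, Equiv.Perm.coe_one, Function.comp_id, hs]
      simp only [PairState.bits_inj]
      rcases a with _ | _ | t | t <;> rcases b with _ | _ | t' | t' <;> try fin_cases t
      all_goals try fin_cases t'
      all_goals simp [PairState.lift, hw]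
      all_goals try ring_nf
      all_goals try simp [Complex.I_sq]
      all_goals try ring
    simp only [hk]
    rw [latticeSum_lift (fun s s' => if s = s' then w s else 0), latticeSum_vertexFun w rfl]
    simp [hw, ← sq]
  · intro x y h
    by_contra h'
    refine h ?_
    rw [Finset.sum_eq_zero, zero_div, zero_mul]
    intro π _
    exact if_neg fun e => h' (bitDegree_eq_of_perm x y π e)
  · intro x y h
    rw [stateMoment_eq_zero h10 h01 x h, mul_zero]

/-! ### From covers and the permanent to lattice sums. -/

/-- The trivial `M`-cover consists of `M` disjoint copies of the graph. -/
theorem BipartiteNFG.coverPartitionSum_one {n : ℕ} {X : Type} [Fintype X]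
    (N : BipartiteNFG n X) (M : ℕ) :
    N.coverPartitionSum (1 : BipartiteNFG.Cover n M) = N.partitionSum ^ M := by
  let e : (Fin M → Fin n → Fin n → X) ≃ (Fin n → Fin n → Fin M → X) :=
    ⟨fun x i j m => x m i j, fun x m i j => x i j m, fun _ => rfl, fun _ => rfl⟩
  have h : N.partitionSum ^ M = ∏ _m : Fin M, N.partitionSum := by simp
  rw [h]
  unfold BipartiteNFG.partitionSum BipartiteNFG.coverPartitionSum
  rw [Finset.prod_univ_sum, Fintype.piFinset_univ, ← e.sum_comp]
  refine Finset.sum_congr rfl fun x _ => ?_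
  rw [Finset.prod_univ_sum, Fintype.piFinset_univ, ← e.sum_comp]
  refine Finset.sum_congr rfl fun y _ => ?_
  unfold BipartiteNFG.globalFunction
  rw [Finset.prod_mul_distrib, Finset.prod_mul_distrib]
  congr 1
  · congr 1
    · rw [Finset.prod_comm]
      rfl
    · symm
      rw [Finset.prod_comm]
      refine Finset.prod_congr rfl fun i _ => ?_
      rw [Finset.prod_comm]
      rfl
  · rw [Finset.prod_comm]
    rfl

theorem edgeWeight_zero (t : ℂ) (a b : Fin 2) :
    edgeWeight t 0 a b = t ^ (a : ℕ) * conj t ^ (b : ℕ) := by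
  fin_cases a <;> fin_cases b <;> simp [edgeWeight, Complex.mul_conj']

/-- The weight of the two copies of an edge in a given state. -/
theorem prod_edgeWeight_zero (t : ℂ) (x : Fin 2 → Fin 2 × Fin 2) :
    ∏ m, edgeWeight t 0 (x m).1 (x m).2 = t ^ (bitDegree x).1 * conj t ^ (bitDegree x).2 := by
  simp only [Fin.prod_univ_two, edgeWeight_zero, bitDegree, pow_add]
  ring

theorem deNFG_coverPartitionSum {n : ℕ} (θ : Matrix (Fin n) (Fin n) ℂ)
    (σ : BipartiteNFG.Cover n 2) :
    (deNFG θ).coverPartitionSum σ = latticeSum checkPair checkPair (fun i j x y =>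
      (if x = y ∘ σ i j then 1 else 0) *
        (θ i j ^ (bitDegree x).1 * conj (θ i j) ^ (bitDegree x).2)) := by
  let e : (Fin n → Fin n → Fin 2 → Fin 2 × Fin 2) ≃ (Fin n → Fin n → Fin 2 → Fin 2 × Fin 2) :=
    Equiv.piCongrRight fun i => Equiv.piCongrRight fun j =>
      ((σ i j).arrowCongr (Equiv.refl _)).symm
  have he : ∀ y i j m, e y i j m = y i j (σ i j m) := fun _ _ _ _ => rfl
  unfold BipartiteNFG.coverPartitionSum latticeSum
  refine Finset.sum_congr rfl fun x _ => ?_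
  -- Relabeling the right variables moves the permutation of the cover from the right vertices into
  -- the edge kernel.
  rw [← e.sum_comp]
  refine Finset.sum_congr rfl fun y _ => ?_
  simp only [he, Equiv.apply_symm_apply]
  congr 1
  congr 1
  refine Finset.prod_congr rfl fun i _ => Finset.prod_congr rfl fun j _ => ?_
  simp only [deNFG, deNFGWithNoise, Matrix.zero_apply]
  rw [Finset.prod_ite_zero, prod_edgeWeight_zero, ite_mul, one_mul, zero_mul]
  simp only [Finset.mem_univ, true_imp_iff, funext_iff, Function.comp_apply]

/-- Averaging over the covers averages the edge kernels. -/
theorem sum_latticeSum_div_card {n : ℕ} {A B I : Type*} [Fintype A] [Fintype B] [Fintype I]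
    (L : (Fin n → A) → ℂ) (R : (Fin n → B) → ℂ) (k : I → Fin n → Fin n → A → B → ℂ) :
    (∑ σ : Fin n → Fin n → I, latticeSum L R (fun i j => k (σ i j) i j)) /
        (Fintype.card (Fin n → Fin n → I) : ℂ) =
      latticeSum L R (fun i j a b => (∑ π, k π i j a b) / Fintype.card I) := by
  classical
  unfold latticeSum
  rw [Finset.sum_comm, Finset.sum_div]
  refine Finset.sum_congr rfl fun x _ => ?_
  rw [Finset.sum_comm, Finset.sum_div]
  refine Finset.sum_congr rfl fun y _ => ?_
  rw [← Finset.sum_mul, ← Finset.mul_sum, mul_div_right_comm, mul_div_assoc]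
  congr 2
  -- A cover is an independent choice on each edge, so the sum over covers of a product over edges
  -- is a product of sums.
  simp only [Finset.prod_div_distrib, Finset.prod_univ_sum, Fintype.piFinset_univ]
  congr 1
  simp

theorem deNFG_averageCover {n : ℕ} (θ : Matrix (Fin n) (Fin n) ℂ) :
    (∑ σ : BipartiteNFG.Cover n 2, (deNFG θ).coverPartitionSum σ) /
        (Fintype.card (BipartiteNFG.Cover n 2) : ℂ) =
      latticeSum checkPair checkPair (fun i j x y =>
        ((∑ π : Equiv.Perm (Fin 2), if x = y ∘ π then 1 else 0) / 2) *
          (θ i j ^ (bitDegree x).1 * conj (θ i j) ^ (bitDegree x).2)) := by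
  simp only [deNFG_coverPartitionSum]
  refine (sum_latticeSum_div_card checkPair checkPair
    (fun (π : Equiv.Perm (Fin 2)) i j x y => (if x = y ∘ π then 1 else 0) *
      (θ i j ^ (bitDegree x).1 * conj (θ i j) ^ (bitDegree x).2))).trans ?_
  have hc : (Fintype.card (Equiv.Perm (Fin 2)) : ℂ) = 2 := by simp [Fintype.card_perm]
  simp only [← Finset.sum_mul, hc, mul_div_right_comm]

theorem deNFG_bethePartitionSum_sq {n : ℕ} (θ : Matrix (Fin n) (Fin n) ℂ) :
    (deNFG θ).bethePartitionSum 2 ^ 2 =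
      latticeSum checkPair checkPair (fun i j x y =>
        ((∑ π : Equiv.Perm (Fin 2), if x = y ∘ π then 1 else 0) / 2) *
          (θ i j ^ (bitDegree x).1 * conj (θ i j) ^ (bitDegree x).2)) := by
  rw [← deNFG_averageCover, BipartiteNFG.bethePartitionSum, one_div,
    Complex.cpow_nat_inv_pow _ two_ne_zero]

theorem deNFG_partitionSum_sq {n : ℕ} (θ : Matrix (Fin n) (Fin n) ℂ) :
    (deNFG θ).partitionSum ^ 2 =
      latticeSum checkPair checkPair (fun i j x y => (if x = y then 1 else 0) *
          (θ i j ^ (bitDegree x).1 * conj (θ i j) ^ (bitDegree x).2)) := by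
  rw [← BipartiteNFG.coverPartitionSum_one, deNFG_coverPartitionSum]
  rfl

/-- The single-edge normal factor graph of the permanent. -/
theorem sum_checkNode_eq_permanent {n : ℕ} (t : Matrix (Fin n) (Fin n) ℂ) :
    ∑ a : Fin n → Fin n → Fin 2, (∏ i, checkNode (a i)) *
      (∏ i, ∏ j, t i j ^ (a i j : ℕ)) * ∏ j, checkNode (fun i => a i j) = t.permanent := by
  have hcol : ∀ (α : Equiv.Perm (Fin n)) j,
      checkNode (fun i => if j = α i then (1 : Fin 2) else 0) = 1 := by
    intro α j
    refine if_pos ⟨α.symm j, by simp, fun i hi => ?_⟩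
    rw [Equiv.eq_symm_apply]
    by_contra h
    simp [Ne.symm h] at hi
  have hcol0 : ∀ α : Fin n → Fin n, ¬ Function.Bijective α →
      ∃ j, checkNode (fun i => if j = α i then (1 : Fin 2) else 0) = 0 := by
    intro α hα
    by_contra! H
    refine hα (Finite.surjective_iff_bijective.1 fun j => ?_)
    by_contra! h
    refine H j (if_neg ?_)
    rintro ⟨i, hi, -⟩
    simp [Ne.symm (h i)] at hi
  calc _ = ∑ α : Fin n → Fin n, (∏ i, t i (α i)) *
        ∏ j, checkNode (fun i => if j = α i then (1 : Fin 2) else 0) := by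
        have : ∀ a : Fin n → Fin n → Fin 2, ∏ i, checkNode (a i) = ∑ α : Fin n → Fin n,
            ∏ i, if a i = fun j => if j = α i then 1 else 0 then 1 else 0 := by
          intro a
          simp only [checkNode_eq_sum]
          rw [Finset.prod_univ_sum, Fintype.piFinset_univ]
        simp only [this, Finset.sum_mul]
        rw [Finset.sum_comm]
        refine Finset.sum_congr rfl fun α _ => ?_
        rw [Finset.sum_eq_single (fun i j => if j = α i then 1 else 0)]
        · simp only [if_true, Finset.prod_const_one, one_mul]
          congr 1
          refine Finset.prod_congr rfl fun i _ => ?_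
          rw [Finset.prod_eq_single (α i)]
          · simp
          · intro j _ hj
            simp [hj]
          · simp
        · intro a _ ha
          obtain ⟨i, hi⟩ := Function.ne_iff.1 ha
          rw [Finset.prod_eq_zero (Finset.mem_univ i) (if_neg hi)]
          ring
        · simp
    _ = ∑ α : Equiv.Perm (Fin n), ∏ i, t i (α i) := by
        rw [sum_eq_sum_perm]
        · simp only [hcol, Finset.prod_const_one, mul_one]
        · intro α hα
          obtain ⟨j, hj⟩ := hcol0 α hα
          exact mul_eq_zero_of_right _ (Finset.prod_eq_zero (Finset.mem_univ j) hj)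
    _ = t.permanent := by
        rw [← Matrix.permanent_transpose]
        rfl

/-- Each edge weight factors as a power of `θ` times a power of `conj θ`, so the unprimed and primed
bits form two independent graphs, one for the permanent and one for its conjugate. -/
theorem deNFG_partitionSum {n : ℕ} (θ : Matrix (Fin n) (Fin n) ℂ) :
    (deNFG θ).partitionSum = θ.permanent * conj θ.permanent := by
  have hconj : conj θ.permanent = (θ.map conj).permanent := by
    simp [Matrix.permanent, map_sum, map_prod]
  rw [hconj, ← sum_checkNode_eq_permanent, ← sum_checkNode_eq_permanent, Finset.sum_mul_sum]
  refine (latticeSum_diag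
    (fun x : Fin n → Fin 2 × Fin 2 => checkNode (fun j => (x j).1) * checkNode (fun j => (x j).2))
    (fun x : Fin n → Fin 2 × Fin 2 => checkNode (fun j => (x j).1) * checkNode (fun j => (x j).2))
    (fun i j x => edgeWeight (θ i j) 0 x.1 x.2)).trans ?_
  let e : (Fin n → Fin n → Fin 2) × (Fin n → Fin n → Fin 2) ≃ (Fin n → Fin n → Fin 2 × Fin 2) :=
    ⟨fun p i j => (p.1 i j, p.2 i j), fun x => (fun i j => (x i j).1, fun i j => (x i j).2),
      fun _ => rfl, fun _ => rfl⟩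
  rw [← e.sum_comp, Fintype.sum_prod_type]
  refine Finset.sum_congr rfl fun a _ => Finset.sum_congr rfl fun b _ => ?_
  simp only [e, Equiv.coe_fn_mk, edgeWeight_zero, Finset.prod_mul_distrib, Matrix.map_apply]
  ring

theorem norm_permanent_pow_four {n : ℕ} (θ : Matrix (Fin n) (Fin n) ℂ) :
    ((‖θ.permanent‖ ^ 4 : ℝ) : ℂ) = (deNFG θ).partitionSum ^ 2 := by
  rw [deNFG_partitionSum, Complex.mul_conj']
  push_cast
  ring

/-! ### Integrability, expectations and the moments in `psi`. -/

theorem integrable_pow_mul_conj_pow {D : Measure ℂ} [IsProbabilityMeasure D]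
    (h22 : Integrable (fun z : ℂ => z ^ 2 * conj z ^ 2) D) {p q : ℕ} (hp : p ≤ 2) (hq : q ≤ 2) :
    Integrable (fun z : ℂ => z ^ p * conj z ^ q) D := by
  -- For `p + q ≤ 4` one has `‖z‖ ^ (p + q) ≤ 1 + ‖z‖ ^ 4`.
  have hbound : Integrable (fun z : ℂ => 1 + ‖z ^ 2 * conj z ^ 2‖) D :=
    (integrable_const 1).add h22.norm
  have hcont : Continuous (fun z : ℂ => z ^ p * conj z ^ q) := by fun_prop
  refine hbound.mono' hcont.aestronglyMeasurable (Filter.Eventually.of_forall fun z => ?_)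
  rw [norm_mul, norm_mul, norm_pow, norm_pow, norm_pow, norm_pow, RCLike.norm_conj, ← pow_add,
    ← pow_add]
  rcases le_total ‖z‖ 1 with h | h
  · have := pow_le_one₀ (n := p + q) (norm_nonneg z) h
    have := pow_nonneg (norm_nonneg z) (2 + 2)
    linarith
  · have := pow_le_pow_right₀ h (show p + q ≤ 2 + 2 by omega)
    linarith

theorem bitDegree_le (x : Fin 2 → Fin 2 × Fin 2) : (bitDegree x).1 ≤ 2 ∧ (bitDegree x).2 ≤ 2 := by
  unfold bitDegree
  constructor <;> dsimp only <;> omega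

section expectation

variable {n : ℕ} {Ω : Type*} [MeasurableSpace Ω] {P : Measure Ω} {D : Measure ℂ}
  [IsProbabilityMeasure D] {θ : Ω → Matrix (Fin n) (Fin n) ℂ}

/-- The expectation of a product of functions of the entries of a matrix with independent
entries of law `D`. -/
theorem integrable_and_integral_prod_entries (hlaw : ∀ i j, HasLaw (fun ω => θ ω i j) D P)
    (hindep : iIndepFun (fun (e : Fin n × Fin n) (ω : Ω) => θ ω e.1 e.2) P)
    (f : Fin n → Fin n → ℂ → ℂ) (hf : ∀ i j, Integrable (f i j) D) :
    Integrable (fun ω => ∏ i, ∏ j, f i j (θ ω i j)) P ∧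
      ∫ ω, ∏ i, ∏ j, f i j (θ ω i j) ∂P = ∏ i, ∏ j, ∫ z, f i j z ∂D := by
  have hpi := iIndepFun.hasLaw_pi (fun e : Fin n × Fin n => hlaw e.1 e.2) hindep
  have hint : Integrable (fun x : Fin n × Fin n → ℂ => ∏ e, f e.1 e.2 (x e))
      (Measure.pi fun _ => D) :=
    Integrable.fintype_prod (f := fun e : Fin n × Fin n => f e.1 e.2) fun e => hf e.1 e.2
  have hprod : ∀ ω, ∏ i, ∏ j, f i j (θ ω i j) = ∏ e : Fin n × Fin n, f e.1 e.2 (θ ω e.1 e.2) :=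
    fun ω => (Fintype.prod_prod_type (fun e : Fin n × Fin n => f e.1 e.2 (θ ω e.1 e.2))).symm
  simp only [hprod]
  constructor
  · rw [← hpi.map_eq] at hint
    exact hint.comp_aemeasurable hpi.aemeasurable
  · refine (hpi.integral_comp hint.aestronglyMeasurable).trans ?_
    rw [integral_fintype_prod_eq_prod (f := fun e : Fin n × Fin n => f e.1 e.2),
      Fintype.prod_prod_type]

/-- The expectation of a partition sum whose edges carry powers of the entries of the matrix. -/
theorem integrable_and_integral_latticeSum (hlaw : ∀ i j, HasLaw (fun ω => θ ω i j) D P)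
    (hindep : iIndepFun (fun (e : Fin n × Fin n) (ω : Ω) => θ ω e.1 e.2) P)
    (h22 : Integrable (fun z : ℂ => z ^ 2 * conj z ^ 2) D)
    (L R : (Fin n → Fin 2 → Fin 2 × Fin 2) → ℂ)
    (κ : (Fin 2 → Fin 2 × Fin 2) → (Fin 2 → Fin 2 × Fin 2) → ℂ) :
    Integrable (fun ω => latticeSum L R (fun i j x y =>
      κ x y * (θ ω i j ^ (bitDegree x).1 * conj (θ ω i j) ^ (bitDegree x).2))) P ∧
    ∫ ω, latticeSum L R (fun i j x y =>
      κ x y * (θ ω i j ^ (bitDegree x).1 * conj (θ ω i j) ^ (bitDegree x).2)) ∂P =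
    latticeSum L R (fun _ _ x y => κ x y * stateMoment (mixedMoment D) x) := by
  have key : ∀ x y : Fin n → Fin n → Fin 2 → Fin 2 × Fin 2, _ := fun x y =>
    integrable_and_integral_prod_entries hlaw hindep
      (fun i j z => κ (x i j) (y i j) * (z ^ (bitDegree (x i j)).1 *
        conj z ^ (bitDegree (x i j)).2))
      fun i j => (integrable_pow_mul_conj_pow h22 (bitDegree_le _).1 (bitDegree_le _).2).const_mul _
  have hint : ∀ x y : Fin n → Fin n → Fin 2 → Fin 2 × Fin 2, Integrable (fun ω =>
      (∏ i, L (x i)) * (∏ i, ∏ j, κ (x i j) (y i j) * (θ ω i j ^ (bitDegree (x i j)).1 *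
        conj (θ ω i j) ^ (bitDegree (x i j)).2)) * ∏ j, R (fun i => y i j)) P := fun x y =>
    ((key x y).1.const_mul _).mul_const _
  unfold latticeSum
  constructor
  · exact integrable_finsetSum _ fun x _ => integrable_finsetSum _ fun y _ => hint x y
  · rw [integral_finsetSum _ fun x _ => integrable_finsetSum _ fun y _ => hint x y]
    refine Finset.sum_congr rfl fun x _ => ?_
    rw [integral_finsetSum _ fun y _ => hint x y]
    refine Finset.sum_congr rfl fun y _ => ?_
    rw [integral_mul_const, integral_const_mul, (key x y).2]
    simp only [integral_const_mul]
    rfl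

end expectation

theorem mixedMoment_swap (D : Measure ℂ) (p q : ℕ) :
    mixedMoment D q p = conj (mixedMoment D p q) := by
  unfold mixedMoment
  rw [← integral_conj]
  congr 1
  funext z
  simp [mul_comm]

theorem mixedMoment_self_re (D : Measure ℂ) (p : ℕ) :
    ((mixedMoment D p p).re : ℂ) = mixedMoment D p p := by
  rw [mixedMoment_self, Complex.ofReal_re]

/-- The diagonal moments are real and `μ_{0,2}` is the conjugate of `μ_{2,0}`, which turns
`|μ_{2,0}|²` into the product found on cycles; of `(n!)²`, one factor cancels against the cycle
index. -/
theorem psi_mixedMoment (n : ℕ) (D : Measure ℂ) (m : ℝ) :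
    (psi n (mixedMoment D 2 2).re ((mixedMoment D 1 1).re ^ 2) m
        (‖mixedMoment D 2 0‖ ^ 2) : ℂ) =
      (n ! : ℂ) * ∑ σ : Equiv.Perm (Fin n), ∏ k ∈ Finset.Icc 1 n,
        (if k = 1 then mixedMoment D 2 2 else m * (mixedMoment D 1 1 ^ 2) ^ k +
          (mixedMoment D 2 0 * mixedMoment D 0 2) ^ k) ^ cycleCount σ k := by
  have hn : (n ! : ℂ) ≠ 0 := by exact_mod_cast n.factorial_ne_zero
  have h20 : mixedMoment D 2 0 * mixedMoment D 0 2 = (‖mixedMoment D 2 0‖ : ℂ) ^ 2 := by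
    rw [mixedMoment_swap D 2 0, Complex.mul_conj']
  rw [h20]
  unfold psi cycleIndex
  push_cast [apply_ite Complex.ofReal]
  rw [mixedMoment_self_re, mixedMoment_self_re]
  field_simp

end

theorem mainTheorem1 (n : ℕ) {Ω : Type*} [MeasurableSpace Ω]
    (P : Measure Ω) [IsProbabilityMeasure P]
    (D : Measure ℂ) [IsProbabilityMeasure D]
    (θ : Ω → Matrix (Fin n) (Fin n) ℂ)
    (hlaw : ∀ i j, HasLaw (fun ω => θ ω i j) D P)
    (hindep : iIndepFun (fun (e : Fin n × Fin n) (ω : Ω) => θ ω e.1 e.2) P)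
    (h22 : Integrable (fun z : ℂ => z ^ 2 * conj z ^ 2) D)
    (h10 : mixedMoment D 1 0 = 0)
    (h20 : ‖mixedMoment D 2 0‖ < (mixedMoment D 1 1).re) :
    (Integrable (fun ω => (deNFG (θ ω)).partitionSum ^ 2) P ∧
      ∫ ω, (deNFG (θ ω)).partitionSum ^ 2 ∂P =
        (psi n (mixedMoment D 2 2).re ((mixedMoment D 1 1).re ^ 2) 2
          (‖mixedMoment D 2 0‖ ^ 2) : ℂ)) ∧
    (Integrable (fun ω => ‖(θ ω).permanent‖ ^ 4) P ∧
      ∫ ω, ‖(θ ω).permanent‖ ^ 4 ∂P =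
        psi n (mixedMoment D 2 2).re ((mixedMoment D 1 1).re ^ 2) 2
          (‖mixedMoment D 2 0‖ ^ 2)) ∧
    (Integrable (fun ω => (deNFG (θ ω)).bethePartitionSum 2 ^ 2) P ∧
      ∫ ω, (deNFG (θ ω)).bethePartitionSum 2 ^ 2 ∂P =
        (psi n (mixedMoment D 2 2).re ((mixedMoment D 1 1).re ^ 2) 1
          (‖mixedMoment D 2 0‖ ^ 2) : ℂ)) := by
  have h00 : mixedMoment D 0 0 = 1 := by simp [mixedMoment]
  have h01 : mixedMoment D 0 1 = 0 := by rw [mixedMoment_swap D 1 0, h10, map_zero]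
  have hZ : Integrable (fun ω => (deNFG (θ ω)).partitionSum ^ 2) P ∧
      ∫ ω, (deNFG (θ ω)).partitionSum ^ 2 ∂P =
        (psi n (mixedMoment D 2 2).re ((mixedMoment D 1 1).re ^ 2) 2
          (‖mixedMoment D 2 0‖ ^ 2) : ℂ) := by
    simp only [deNFG_partitionSum_sq]
    obtain ⟨h1, h2⟩ := integrable_and_integral_latticeSum hlaw hindep h22 checkPair checkPair
      (fun x y => if x = y then 1 else 0)
    refine ⟨h1, h2.trans ?_⟩
    rw [latticeSum_moment_trivialCover _ h00 h10 h01, psi_mixedMoment]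
    push_cast
    rfl
  refine ⟨hZ, ?_, ?_⟩
  -- The value of `Z²` is the real number `|perm θ|⁴`, so the complex integral already computed
  -- gives the real one.
  · have hre : ∀ ω, ‖(θ ω).permanent‖ ^ 4 = ((deNFG (θ ω)).partitionSum ^ 2).re := fun ω => by
      rw [← norm_permanent_pow_four, Complex.ofReal_re]
    constructor
    · simp only [hre]
      exact hZ.1.re
    · rw [← Complex.ofReal_inj, ← integral_complex_ofReal]
      simp only [norm_permanent_pow_four]
      exact hZ.2
  · simp only [deNFG_bethePartitionSum_sq]
    obtain ⟨h1, h2⟩ := integrable_and_integral_latticeSum hlaw hindep h22 checkPair checkPair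
      (fun x y => (∑ π : Equiv.Perm (Fin 2), if x = y ∘ π then 1 else 0) / 2)
    refine ⟨h1, h2.trans ?_⟩
    rw [latticeSum_moment_averageCover _ h00 h10 h01, psi_mixedMoment]
    simp only [Complex.ofReal_one, one_mul]
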